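/- **Setting.** A *tract* is a commutative group with zero $T$ (so $T^\times=T-\{0\}$) together with an ideal $N_T$ of the semiring $\mathbb{N}[T^\times]$ such that for every $a\in T$ there is a unique $-a\in T$ with $a+(-a)\in N_T$ (here $0\in T$ is identified with the zero of $\mathbb{N}[T^\times]$). Let $E$ be a finite set. A *Grassmann–Plücker function* of rank $r$ is an alternating function $\varphi:E^r\to T$ such that the sets $\{x_1,\dots,x_r\}$ with $\varphi(x_1,\dots,x_r)\ne 0$ are the bases of a matroid $M$ on $E$ (the *underlying matroid*) and such that $\varphi$ satisfies the $3$-term Plücker relations $$\varphi(x,a,b)\varphi(x,c,d)-\varphi(x,a,c)\varphi(x,b,d)+\varphi(x,a,d)\varphi(x,b,c)\in N_T\qquad(x\in E^{r-2},\ a,b,c,d\in E).$$ A *$T$-matroid* is a class $[\varphi]$ of such functions modulo $T^\times$; it is *simple* if $M$ is simple. Two elements $X,Y\in T^E$ are *orthogonal* if $\sum_{e\in E} X(e)Y(e)\in N_T$, and $S^\perp$ is the set of all $X\in T^E$ orthogonal to every element of $S\subset T^E$. The *vector set* of $[\varphi]$ is $$\mathcal V_\varphi=\Big\{X\in T^E\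 \Big|\ \sum_{e\in E}X(e)\,\varphi(i_1,\dots,i_{r-1},e)\in N_T\text{ for all }i_1,\dots,i_{r-1}\in E\Big\}$$ (all of $T^E$ if $r=0$), and the *covector set* is $\mathcal V^*_\varphi=\mathcal V_{\varphi^*}$, where, for a chosen total order of $E$ and every enumeration $(d_1,\dots,d_{n-r},e_1,\dots,e_r)$ of $E$, $\varphi^*(d_1,\dots,d_{n-r})=\mathrm{sign}(d_1,\dots,d_{n-r},e_1,\dots,e_r)\,\varphi(e_1,\dots,e_r)$, and $\varphi^*$ is zero on tuples with repeated entries. The tract $T$ is *perfect* if $X\perp Y$ for all $X\in\mathcal V_\varphi$ and $Y\in\mathcal V^*_\varphi$, for every $T$-matroid $[\varphi]$. For a flat $F$ of $M$ with basis $i_1,\dots,i_k$, the *$T$-flat* $\mathcal V_F$ of $[\varphi]$ over $F$ is the vector set of the $T$-matroid represented by $(e_1,\dots,e_{r-k})\mapsto\varphi(i_1,\dots,i_k,e_1,\dots,e_{r-k})$. For $\mathcal V\subset T^E$, a *support basis* is an inclusion-minimal $B\subset E$ that meets the support of every nonzero element of $\mathcal V$. A *normal form* for $\mathcal V$ indexed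 by $J\subset E$ is a family $(S_i)_{i\in J}$ in $\mathcal V$ with $S_i(j)=\delta_{i,j}$ for $i,j\in J$. The set $\mathcal V$ is a *linear subspace* of $T^E$ if it is closed under multiplication by elements of $T$ and consists of exactly those $X\in T^E$ for which $X(e)-\sum_{a\in B}X(a)S_a(e)\in N_T$ for every support basis $B$ of $\mathcal V$, every normal form $(S_a)_{a\in B}$ for $\mathcal V$ and every $e\in E-B$. Its *dimension* is the cardinality of $J$ for any normal form for $\mathcal V$ whose index set $J$ is maximal. **Proposition E.** Let $T$ be a perfect tract and $[\varphi]$ a simple $T$-matroid on the finite set $E$ with underlying matroid $M$. For $i\in E$ let $H_i=\{X\in\mathcal V^*_\varphi\mid X(i)=0\}$, and for $S\subset E$ let $H_S=\bigcap_{i\in S}H_i$, taken inside $\mathcal V^*_\varphi$ (so $H_\emptyset=\mathcal V^*_\varphi$). Then a subset $F\subset E$ is a flat of $M$ if and only if $F=\{i\in E\mid H_F\subset H_i\}$. In this case, $H_F=\mathcal V_F^\perp$, and $H_F$ is a linear subspace of $T^E$ of dimension $\operatorname{cork}F$, the corank of $F$ in $M$. -/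

import Mathlib

open scoped Classical in
/-- The map from a pointed group `T` to its ambient semiring `ℕ[Tˣ]`, sending `0` to `0` and a
nonzero `a` to the basis element `1.a`. -/
noncomputable def ambient {T : Type*} [CommGroupWithZero T] (a : T) : MonoidAlgebra ℕ Tˣ :=
  if h : a = 0 then 0 else MonoidAlgebra.single (Units.mk0 a h) 1

/-- An (ideal) tract: a pointed group `T`, i.e. a commutative group with zero, together with an
ideal of `ℕ[Tˣ]`, the nullset, such that every `a` has a unique additive inverse. -/
class Tract (T : Type*) extends CommGroupWithZero T where
  nullset : Ideal (MonoidAlgebra ℕ Tˣ)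
  existsUnique_neg : ∀ a : T, ∃! b : T, ambient a + ambient b ∈ nullset

namespace Tract

section Basics

variable {T : Type*} [Tract T]

/-- The additive inverse of `a`. -/
noncomputable def neg (a : T) : T := (existsUnique_neg a).choose

/-- The element `1` or `-1` of `T` given by a sign. -/
noncomputable def ofSign (ε : ℤˣ) : T := if ε = 1 then 1 else neg 1

/-- The sum `∑ e, f e`, taken in the ambient semiring, lies in the nullset. -/
def SumNull {ι : Type*} [Fintype ι] (f : ι → T) : Prop :=
  ∑ e, ambient (f e) ∈ (nullset : Ideal (MonoidAlgebra ℕ Tˣ))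

/-- Orthogonality of two elements of `T^E`. -/
def Orth {E : Type*} [Fintype E] (X Y : E → T) : Prop := SumNull fun e => X e * Y e

/-- The orthogonal complement of a subset of `T^E`. -/
def perp {E : Type*} [Fintype E] (S : Set (E → T)) : Set (E → T) := {X | ∀ Y ∈ S, Orth X Y}

end Basics

section GrassmannPlucker

variable {T : Type*} [Tract T] {E : Type*} {r : ℕ}

/-- The family of subsets `{x₁, …, x_r}` with `φ (x₁, …, x_r) ≠ 0`. -/
def IsBaseOf (φ : (Fin r → E) → T) (B : Set E) : Prop :=
  ∃ x : Fin r → E, Set.range x = B ∧ φ x ≠ 0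

/-- (Weak) Grassmann-Plücker functions of rank `r` on `E` with coefficients in `T`. The `T`-matroids
of rank `r` on `E` are the classes of such functions modulo multiplication by elements of `Tˣ`. -/
structure IsGrassmannPlucker (φ : (Fin r → E) → T) : Prop where
  exists_base : ∃ B, IsBaseOf φ B
  exchange : Matroid.ExchangeProperty (IsBaseOf φ)
  map_perm : ∀ (x : Fin r → E) (σ : Equiv.Perm (Fin r)),
    φ (x ∘ σ) = ofSign (Equiv.Perm.sign σ) * φ x
  map_not_injective : ∀ x : Fin r → E, ¬ Function.Injective x → φ x = 0
  plucker : ∀ (m : ℕ) (h : r = m + 2) (x : Fin m → E) (a b c d : E),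
    let ψ : E → E → T := fun u v => φ (Fin.append x ![u, v] ∘ Fin.cast h)
    ambient (ψ a b * ψ c d) + ambient (neg (ψ a c * ψ b d)) + ambient (ψ a d * ψ b c) ∈
      (nullset : Ideal (MonoidAlgebra ℕ Tˣ))

/-- The underlying matroid, on the ground set `E`, of the `T`-matroid `[φ]`. -/
def underlyingMatroid [Finite E] (φ : (Fin r → E) → T) (hφ : IsGrassmannPlucker φ) : Matroid E :=
  Matroid.ofIsBaseOfFinite (E := Set.univ) Set.finite_univ (IsBaseOf φ) hφ.exists_base hφ.exchange
    fun B _ => Set.subset_univ B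

/-- The vector set of `[φ]`. In rank `0` there is no tuple of length `r - 1`, so that the vector
set is all of `T^E`. -/
def vectors [Fintype E] (φ : (Fin r → E) → T) : Set (E → T) :=
  {X | ∀ (m : ℕ) (h : r = m + 1) (i : Fin m → E),
    SumNull fun e => X e * φ ((Fin.snoc i e : Fin (m + 1) → E) ∘ Fin.cast h)}

open scoped Classical in
/-- The dual Grassmann-Plücker function: if `(d, e)` is an enumeration of `E`, then
`φ* d = sign (d, e) * φ e`, which does not depend on the choice of `e` when `φ` is alternating; if
there is no such `e`, the value is `0`. Here `sign (d, e)` is the sign of the permutation that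
sorts the tuple `(d, e)`. -/
noncomputable def dual [Fintype E] [LinearOrder E] (φ : (Fin r → E) → T) :
    (Fin (Fintype.card E - r) → E) → T := fun d =>
  if h : ∃ e : Fin r → E, Function.Bijective (Fin.append d e) then
    ofSign (Equiv.Perm.sign (Tuple.sort (Fin.append d h.choose))) * φ h.choose
  else 0

/-- The covector set of `[φ]`. -/
def covectors [Fintype E] [LinearOrder E] (φ : (Fin r → E) → T) : Set (E → T) :=
  vectors (dual φ)

end GrassmannPlucker

/-- A tract is perfect if vectors are orthogonal to covectors for all `T`-matroids. (The ground
set, being finite, may be taken to be `{0, …, n - 1}`.) -/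
def IsPerfect (T : Type*) [Tract T] : Prop :=
  ∀ (n r : ℕ) (φ : (Fin r → Fin n) → T), IsGrassmannPlucker φ →
    ∀ X ∈ vectors φ, ∀ Y ∈ covectors φ, Orth X Y

section LinearSubspaces

variable {T : Type*} [Tract T] {E : Type*} [Fintype E]

/-- `B` is a support basis for `V`: it is inclusion minimal among the subsets of `E` that meet the
support of every nonzero element of `V`. -/
def IsSupportBasis (V : Set (E → T)) (B : Finset E) : Prop :=
  Minimal (fun C : Finset E => ∀ X ∈ V, X ≠ 0 → ∃ e ∈ C, X e ≠ 0) B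

open scoped Classical in
/-- `S` is a normal form for `V`, indexed by `J`. -/
def IsNormalForm (V : Set (E → T)) (J : Finset E) (S : J → E → T) : Prop :=
  (∀ i, S i ∈ V) ∧ ∀ i j : J, S i j = if i = j then 1 else 0

/-- The span of a family `S` indexed by `B`: the `X` with `X(e) - ∑_{a ∈ B} X(a) S_a(e)` in the
nullset for all `e ∉ B`. -/
def span (B : Finset E) (S : B → E → T) : Set (E → T) :=
  {X | ∀ e ∉ B, ambient (X e) + ∑ a : B, ambient (neg (X a * S a e)) ∈
    (nullset : Ideal (MonoidAlgebra ℕ Tˣ))}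

/-- Linear subspaces of `T^E`: the `T`-invariant subsets that are the intersection of the spans of
all their normal bases. -/
structure IsLinearSubspace (V : Set (E → T)) : Prop where
  smul_mem : ∀ (a : T), ∀ X ∈ V, (fun e => a * X e) ∈ V
  eq_span : V = {X | ∀ (B : Finset E) (S : B → E → T),
    IsSupportBasis V B → IsNormalForm V B S → X ∈ span B S}

/-- `J` is the index set of a maximal normal form for `V`. -/
def IsMaximalNormalIndex (V : Set (E → T)) (J : Finset E) : Prop :=
  Maximal (fun K : Finset E => ∃ S : K → E → T, IsNormalForm V K S) J

/-- A linear subspace has dimension `d` if its maximal normal forms have `d` members. -/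
structure HasDimension (V : Set (E → T)) (d : ℕ) : Prop where
  exists_index : ∃ J, IsMaximalNormalIndex V J
  card_index : ∀ J, IsMaximalNormalIndex V J → J.card = d

end LinearSubspaces

section Flats

variable {T : Type*} [Tract T] {E : Type*} [Fintype E] {r : ℕ}

/-- The Grassmann-Plücker function `(e₁, …, e_s) ↦ φ (i₁, …, i_k, e₁, …, e_s)`. If `i₁, …, i_k`
is a basis of the flat `F`, then it represents the `F`-quotient of `[φ]`. -/
def quotientBy {k s : ℕ} (h : r = k + s) (φ : (Fin r → E) → T) (i : Fin k → E) :
    (Fin s → E) → T := fun e => φ (Fin.append i e ∘ Fin.cast h)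

/-- The `T`-flat of `[φ]` over `F`: the vector set of the `F`-quotient of `[φ]`. A basis
`i₁, …, i_k` of `F` changes the function representing the `F`-quotient only by a nonzero factor, so
all choices give the same vector set. -/
def tFlat (φ : (Fin r → E) → T) (hφ : IsGrassmannPlucker φ) (F : Set E) : Set (E → T) :=
  {X | ∀ (k s : ℕ) (h : r = k + s) (i : Fin k → E), Function.Injective i →
    (underlyingMatroid φ hφ).IsBasis (Set.range i) F → X ∈ vectors (quotientBy h φ i)}

variable [LinearOrder E]

/-- The member `H_i` of the canonical hyperplane arrangement of `[φ]`. -/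
def arrangement (φ : (Fin r → E) → T) (i : E) : Set (E → T) :=
  {X | X ∈ covectors φ ∧ X i = 0}

/-- The intersection `H_S` of the `H_i` with `i ∈ S`, taken inside the covector set, so that
`H_∅` is the covector set. -/
def arrangementInter (φ : (Fin r → E) → T) (S : Set E) : Set (E → T) :=
  covectors φ ∩ ⋂ i ∈ S, arrangement φ i

end Flats

end Tract

/-- A matroid is simple if it has no loops and no parallel elements, i.e. no circuits with fewer
than three elements. -/
def Matroid.IsSimple {α : Type*} (M : Matroid α) : Prop :=
  ∀ C, M.IsCircuit C → 2 < C.encard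

/-- The corank of a subset of a matroid of finite rank. -/
noncomputable def Matroid.corank {α : Type*} (M : Matroid α) (F : Set α) : ℕ :=
  (M.eRank - M.eRk F).toNat

/-! The proof replaces covectors by Cramer's rule. Along an enumeration (i, e, b) of `E`, the
equation of `φ*` at (i, ·) becomes `Cramer φ X b e`: orthogonality of `X` to the circuit in b ∪ {e}.
In this form neither the dual nor the order of `E` appears, and contraction is easy to control.

The hard point is that cocircuits are covectors (`isCovector_cocircuit`): over a perfect tract the
3-term relations imply all Plücker relations. The argument is an induction on the rank. Two tuples
with a common element reduce to a contraction. In general, contract one entry a of the cocircuit's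
tuple and restrict to b ∪ {e}: there the circuit is a vector and the cocircuit a covector, by the
cases already known, and perfection makes them orthogonal.

The covector set then behaves like a row space whose reduced echelon forms consist of cocircuits.
Its support bases are the bases of the matroid, the only normal form on a base is given by its
cocircuits, and lying in the span is Cramer's rule. Hence it is a linear subspace of dimension r.

For i a basis of F, there is a chain H_F ⊆ covectors of the quotient by i ⊆ V_F^⊥ ⊆ H_F. The steps
hold because coordinates in F vanish, by perfection, and because V_F contains the circuits of φ and
the unit vectors at F. So H_F is itself a covector set, of rank cork F. Finally {i | H_F ⊆ H_i} is
the closure of F, since cocircuits separate F from the points outside its closure. -/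

namespace Tract

open Function

/-! ### Arithmetic in a tract -/

section Arithmetic

variable {T : Type*} [Tract T]

@[simp] lemma ambient_zero : ambient (0 : T) = 0 := by simp [ambient]

lemma ambient_mul (a b : T) : ambient (a * b) = ambient a * ambient b := by
  by_cases ha : a = 0
  · simp [ha]
  by_cases hb : b = 0
  · simp [hb]
  have hab : a * b ≠ 0 := mul_ne_zero ha hb
  simp only [ambient, ha, hb, hab, dite_false, MonoidAlgebra.single_mul_single, mul_one]
  congr 1
  ext
  simp

lemma ambient_mul_mem (a : T) {s : MonoidAlgebra ℕ Tˣ}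
    (hs : s ∈ (nullset : Ideal (MonoidAlgebra ℕ Tˣ))) : ambient a * s ∈ nullset :=
  Ideal.mul_mem_left _ _ hs

lemma ambient_add_neg (a : T) : ambient a + ambient (neg a) ∈ nullset :=
  (existsUnique_neg a).choose_spec.1

lemma eq_neg_of_mem {a b : T} (h : ambient a + ambient b ∈ nullset) : b = neg a :=
  (existsUnique_neg a).choose_spec.2 b h

@[simp] lemma neg_zero' : neg (0 : T) = 0 :=
  (eq_neg_of_mem (by simp)).symm

lemma eq_zero_of_ambient_mem {a : T} (h : ambient a ∈ (nullset : Ideal (MonoidAlgebra ℕ Tˣ))) :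
    a = 0 := by
  rw [eq_neg_of_mem (a := 0) (b := a) (by simpa using h), neg_zero']

@[simp] lemma neg_neg' (a : T) : neg (neg a) = a :=
  (eq_neg_of_mem (by rw [add_comm]; exact ambient_add_neg a)).symm

lemma mul_neg' (a b : T) : a * neg b = neg (a * b) := by
  apply eq_neg_of_mem
  rw [ambient_mul, ambient_mul, ← mul_add]
  exact ambient_mul_mem _ (ambient_add_neg b)

lemma neg_mul' (a b : T) : neg a * b = neg (a * b) := by
  rw [mul_comm, mul_neg', mul_comm]

@[simp] lemma neg_eq_zero' {a : T} : neg a = 0 ↔ a = 0 := by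
  refine ⟨fun h => ?_, fun h => by simp [h]⟩
  rw [← neg_neg' a, h, neg_zero']

lemma ambient_mul_mem_iff {a : T} (ha : a ≠ 0) {s : MonoidAlgebra ℕ Tˣ} :
    ambient a * s ∈ nullset ↔ s ∈ (nullset : Ideal (MonoidAlgebra ℕ Tˣ)) := by
  refine ⟨fun h => ?_, ambient_mul_mem a⟩
  have h1 := ambient_mul_mem a⁻¹ h
  have h2 : ambient (1 : T) = 1 := by
    simp [ambient, MonoidAlgebra.one_def]
  rwa [← mul_assoc, ← ambient_mul, inv_mul_cancel₀ ha, h2, one_mul] at h1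

@[simp] lemma ofSign_one : ofSign (1 : ℤˣ) = (1 : T) := by simp [ofSign]

@[simp] lemma ofSign_neg_one : ofSign (-1 : ℤˣ) = (neg 1 : T) := by
  rw [ofSign, if_neg (by decide)]

lemma ofSign_neg_mul (ε : ℤˣ) (a : T) : ofSign (-ε) * a = neg (ofSign ε * a) := by
  rcases Int.units_eq_one_or ε with rfl | rfl <;> simp [neg_mul']

lemma ofSign_mul (ε η : ℤˣ) : (ofSign (ε * η) : T) = ofSign ε * ofSign η := by
  rcases Int.units_eq_one_or ε with rfl | rfl <;> rcases Int.units_eq_one_or η with rfl | rfl <;>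
    simp [neg_mul']

lemma ofSign_ne_zero (ε : ℤˣ) : (ofSign ε : T) ≠ 0 := by
  rcases Int.units_eq_one_or ε with rfl | rfl <;> simp

lemma sumNull_comp_equiv {ι κ : Type*} [Fintype ι] [Fintype κ] (σ : ι ≃ κ) (f : κ → T) :
    SumNull (fun e => f (σ e)) ↔ SumNull f := by
  simp only [SumNull, Equiv.sum_comp σ (fun e => ambient (f e))]

lemma orth_comm {E : Type*} [Fintype E] {X Y : E → T} : Orth X Y ↔ Orth Y X := by
  simp only [Orth, mul_comm]

/-- Summing over `E` a function supported on an injectively enumerated subset. -/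
lemma sum_extend {ι E M : Type*} [Fintype ι] [Fintype E] [AddCommMonoid M] {x : ι → E}
    (hx : Injective x) (f : E → M) (hf : ∀ z ∉ Set.range x, f z = 0) :
    ∑ z, f z = ∑ l, f (x l) := by
  classical
  rw [← Finset.sum_image (s := Finset.univ) (g := x) (fun a _ b _ h => hx h)]
  refine (Finset.sum_subset (Finset.subset_univ _) fun z _ hz => hf z ?_).symm
  simpa using hz

end Arithmetic

/-! ### Alternating functions and Cramer's rule -/

section Cramer

variable {T : Type*} [Tract T] {E : Type*} {r : ℕ}

/-- An alternating function. -/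
structure IsAlternating (φ : (Fin r → E) → T) : Prop where
  map_perm : ∀ (x : Fin r → E) (σ : Equiv.Perm (Fin r)),
    φ (x ∘ σ) = ofSign (Equiv.Perm.sign σ) * φ x
  map_not_injective : ∀ x : Fin r → E, ¬ Injective x → φ x = 0

lemma IsGrassmannPlucker.isAlternating {φ : (Fin r → E) → T} (hφ : IsGrassmannPlucker φ) :
    IsAlternating φ := ⟨hφ.map_perm, hφ.map_not_injective⟩

variable {φ : (Fin r → E) → T}

lemma IsAlternating.injective (hφ : IsAlternating φ) {b : Fin r → E} (h : φ b ≠ 0) :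
    Injective b := by
  by_contra hb
  exact h (hφ.map_not_injective b hb)

lemma IsAlternating.eq_zero (hφ : IsAlternating φ) {b : Fin r → E} {i j : Fin r} (hij : i ≠ j)
    (h : b i = b j) : φ b = 0 :=
  hφ.map_not_injective b fun hb => hij (hb h)

lemma IsAlternating.map_swap (hφ : IsAlternating φ) (b : Fin r → E) {i j : Fin r} (hij : i ≠ j) :
    φ (b ∘ Equiv.swap i j) = neg (φ b) := by
  rw [hφ.map_perm, Equiv.Perm.sign_swap hij, ofSign_neg_one, neg_mul', one_mul]

lemma IsAlternating.map_perm_ne_zero (hφ : IsAlternating φ) {b : Fin r → E}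
    (σ : Equiv.Perm (Fin r)) : φ (b ∘ σ) ≠ 0 ↔ φ b ≠ 0 := by
  rw [hφ.map_perm, mul_ne_zero_iff]
  simp [ofSign_ne_zero]

lemma exists_perm_of_range_eq {n : ℕ} {x y : Fin n → E} (hx : Injective x) (hy : Injective y)
    (h : Set.range x = Set.range y) : ∃ σ : Equiv.Perm (Fin n), y = x ∘ σ := by
  refine ⟨(Equiv.ofInjective y hy).trans
    ((Equiv.setCongr h.symm).trans (Equiv.ofInjective x hx).symm), ?_⟩
  funext l
  exact (Equiv.apply_ofInjective_symm hx ⟨y l, h ▸ ⟨l, rfl⟩⟩).symm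

lemma injective_of_range_eq {n : ℕ} {x y : Fin n → E} (hx : Injective x)
    (h : Set.range x = Set.range y) : Injective y := by
  have h1 : (Set.range y).ncard = n := by
    rw [← h, ← Set.image_univ, Set.ncard_image_of_injective _ hx, Set.ncard_univ, Nat.card_fin]
  have : Surjective (fun l => (⟨y l, l, rfl⟩ : Set.range y)) := by
    rintro ⟨_, l, rfl⟩
    exact ⟨l, rfl⟩
  have hb : Injective (fun l => (⟨y l, l, rfl⟩ : Set.range y)) := by
    have := Finite.of_surjective _ this
    refine ((Function.Surjective.bijective_of_nat_card_le ‹_› ?_)).1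
    rw [Nat.card_coe_set_eq, h1, Nat.card_fin]
  intro i j hij
  exact hb (Subtype.ext hij)

lemma IsAlternating.ne_zero_of_range_eq (hφ : IsAlternating φ) {x y : Fin r → E} (hx : φ x ≠ 0)
    (h : Set.range x = Set.range y) : φ y ≠ 0 := by
  obtain ⟨σ, rfl⟩ := exists_perm_of_range_eq (hφ.injective hx)
    (injective_of_range_eq (hφ.injective hx) h) h
  exact (hφ.map_perm_ne_zero σ).2 hx

lemma IsAlternating.isBaseOf_range (hφ : IsAlternating φ) {x : Fin r → E} :
    IsBaseOf φ (Set.range x) ↔ φ x ≠ 0 :=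
  ⟨fun ⟨_, h1, h2⟩ => hφ.ne_zero_of_range_eq h2 h1, fun h => ⟨x, rfl, h⟩⟩

/-- Cramer's rule for `X` at `b` and `e`: `X(e) φ(b) - ∑ l, X(b_l) φ(b with b_l replaced by e)` is
null. It expresses that `X` is orthogonal to the circuit in `b ∪ {e}`. -/
def Cramer (φ : (Fin r → E) → T) (X : E → T) (b : Fin r → E) (e : E) : Prop :=
  ambient (X e * φ b) + ∑ l, ambient (neg (X (b l) * φ (update b l e))) ∈
    (nullset : Ideal (MonoidAlgebra ℕ Tˣ))

/-- `X` is orthogonal to all circuits of `[φ]`. -/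
def IsCovector (φ : (Fin r → E) → T) (X : E → T) : Prop := ∀ b e, Cramer φ X b e

lemma update_comp_perm {n : ℕ} (b : Fin n → E) (σ : Equiv.Perm (Fin n)) (l : Fin n) (e : E) :
    update (b ∘ σ) l e = update b (σ l) e ∘ σ := by
  funext k
  simp [update_apply, σ.injective.eq_iff]

lemma cramer_perm (hφ : IsAlternating φ) (X : E → T) (b : Fin r → E) (e : E)
    (σ : Equiv.Perm (Fin r)) : Cramer φ X (b ∘ σ) e ↔ Cramer φ X b e := by
  unfold Cramer
  rw [← ambient_mul_mem_iff (ofSign_ne_zero (T := T) (Equiv.Perm.sign σ))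
      (s := ambient (X e * φ b) + _), mul_add, Finset.mul_sum, ← ambient_mul]
  simp only [update_comp_perm, hφ.map_perm, ← ambient_mul, mul_neg', comp_apply,
    mul_left_comm (X _)]
  rw [Equiv.sum_comp σ fun l =>
    ambient (neg (ofSign (Equiv.Perm.sign σ) * (X (b l) * φ (update b l e))))]

/-- Up to sign, the relation depends only on the entries of (e, b). Exchanging e with b_s
interchanges the leading term and the s-th one; in the other terms the argument of φ changes by a
transposition. -/
lemma cramer_exchange (hφ : IsAlternating φ) {X : E → T} {b : Fin r → E} {e : E} (s : Fin r)
    (h : Cramer φ X (update b s e) (b s)) : Cramer φ X b e := by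
  unfold Cramer at h ⊢
  rw [← ambient_mul_mem_iff (a := neg 1) (by simp), mul_add, Finset.mul_sum]
  rw [← Finset.add_sum_erase _ _ (Finset.mem_univ s)] at h ⊢
  have hu : ∀ l ∈ Finset.univ.erase s,
      ambient (neg (X (update b s e l) * φ (update (update b s e) l (b s)))) =
        ambient (neg 1) * ambient (neg (X (b l) * φ (update b l e))) := by
    intro l hl
    have hl : l ≠ s := by simpa using hl
    have h1 : update (update b s e) l (b s) = update b l e ∘ Equiv.swap l s := by
      funext k
      by_cases hk : k = l
      · subst hk
        simp [hl.symm]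
      by_cases hk' : k = s
      · subst hk'
        simp [hk]
      · simp [hk, hk', Equiv.swap_apply_of_ne_of_ne]
    rw [h1, hφ.map_swap _ hl, ← ambient_mul, mul_neg', neg_neg', neg_mul', one_mul, neg_neg',
      update_of_ne hl]
  rw [Finset.sum_congr rfl hu] at h
  simp only [update_self, update_idem, update_eq_self] at h
  rw [← ambient_mul, ← ambient_mul, neg_mul', neg_mul', one_mul, one_mul, neg_neg']
  rwa [add_left_comm] at h

lemma cramer_mem (hφ : IsAlternating φ) (X : E → T) (b : Fin r → E) (s : Fin r) :
    Cramer φ X b (b s) := by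
  unfold Cramer
  rw [Finset.sum_eq_single s, update_eq_self]
  · exact ambient_add_neg _
  · intro l _ hl
    rw [hφ.eq_zero hl (b := update b l (b s)) (by simp [hl.symm])]
    simp
  · simp

/-- If `φ b = 0`, either some exchange with e yields a base, or every term of the relation is zero.
-/
lemma isCovector_of_ne_zero (hφ : IsAlternating φ) {X : E → T}
    (h : ∀ b e, φ b ≠ 0 → Cramer φ X b e) : IsCovector φ X := by
  intro b e
  by_cases hb : φ b = 0
  · by_cases hs : ∃ s, φ (update b s e) ≠ 0
    · obtain ⟨s, hs⟩ := hs
      exact cramer_exchange hφ s (h _ _ hs)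
    · push Not at hs
      simp [Cramer, hb, hs]
  · exact h b e hb

end Cramer

/-! ### Quotients, restrictions and bases -/

section Minors

variable {T : Type*} [Tract T] {E : Type*} {r : ℕ}

lemma range_update {n : ℕ} {b : Fin n → E} (hb : Injective b) (l : Fin n) (f : E) :
    Set.range (update b l f) = insert f (Set.range b \ {b l}) := by
  ext z
  simp only [Set.mem_range, Set.mem_insert_iff, Set.mem_sdiff, Set.mem_singleton_iff]
  constructor
  · rintro ⟨k, rfl⟩
    by_cases hk : k = l
    · subst hk
      simp
    · simp [hk, hb.eq_iff]
  · rintro (rfl | ⟨⟨k, rfl⟩, hk⟩)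
    · exact ⟨l, by simp⟩
    · exact ⟨k, by rw [update_of_ne]; rintro rfl; exact hk rfl⟩

lemma append_update {k s : ℕ} (i : Fin k → E) (w : Fin s → E) (l : Fin s) (f : E) :
    Fin.append i (update w l f) = update (Fin.append i w) (Fin.natAdd k l) f := by
  funext z
  refine Fin.addCases (fun j => ?_) (fun j => ?_) z
  · rw [Fin.append_left, update_of_ne, Fin.append_left]
    simp [Fin.ext_iff]
    omega
  · rw [Fin.append_right]
    by_cases hj : j = l
    · subst hj
      simp
    · rw [update_of_ne hj, update_of_ne, Fin.append_right]
      simpa using hj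

lemma append_comp_perm {k s : ℕ} (i : Fin k → E) (w : Fin s → E) (σ : Equiv.Perm (Fin s)) :
    Fin.append i (w ∘ σ) =
      Fin.append i w ∘ finSumFinEquiv.permCongr (Equiv.Perm.sumCongr 1 σ) := by
  funext z
  refine Fin.addCases (fun j => ?_) (fun j => ?_) z <;> simp [Equiv.permCongr_apply]

lemma IsGrassmannPlucker.exists_update {φ : (Fin r → E) → T} (hφ : IsGrassmannPlucker φ)
    {b c : Fin r → E} (hb : φ b ≠ 0) (hc : φ c ≠ 0) {l : Fin r} (hl : b l ∉ Set.range c) :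
    ∃ t, c t ∉ Set.range b ∧ φ (update b l (c t)) ≠ 0 := by
  obtain ⟨f, ⟨⟨t, rfl⟩, hf⟩, h⟩ := hφ.exchange _ _ ⟨b, rfl, hb⟩ ⟨c, rfl, hc⟩ (b l) ⟨⟨l, rfl⟩, hl⟩
  refine ⟨t, hf, ?_⟩
  rw [← range_update (hφ.isAlternating.injective hb)] at h
  exact hφ.isAlternating.isBaseOf_range.1 h

lemma exchangeProperty_of_exists_update {φ : (Fin r → E) → T} (hφ : IsAlternating φ)
    (h : ∀ (b c : Fin r → E) (l : Fin r), φ b ≠ 0 → φ c ≠ 0 → b l ∉ Set.range c →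
      ∃ t, c t ∉ Set.range b ∧ φ (update b l (c t)) ≠ 0) :
    Matroid.ExchangeProperty (IsBaseOf φ) := by
  rintro _ _ ⟨b, rfl, hb⟩ ⟨c, rfl, hc⟩ _ ⟨⟨l, rfl⟩, hl⟩
  obtain ⟨t, ht, h⟩ := h b c l hb hc hl
  refine ⟨c t, ⟨⟨t, rfl⟩, ht⟩, ?_⟩
  rw [← range_update (hφ.injective hb)]
  exact ⟨_, rfl, h⟩

lemma IsAlternating.quotientBy {k s : ℕ} (h : r = k + s) {φ : (Fin r → E) → T}
    (hφ : IsAlternating φ) (i : Fin k → E) : IsAlternating (quotientBy h φ i) := by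
  subst h
  constructor
  · intro x σ
    simp only [Tract.quotientBy, Fin.cast_refl, comp_id]
    rw [append_comp_perm, hφ.map_perm, Equiv.Perm.sign_permCongr, Equiv.Perm.sign_sumCongr]
    simp
  · intro x hx
    refine hφ.map_not_injective _ fun hinj => hx ?_
    simp only [Fin.cast_refl, comp_id] at hinj
    exact (Fin.append_injective_iff.1 hinj).2.1

lemma IsGrassmannPlucker.quotientBy {k s : ℕ} (h : r = k + s) {φ : (Fin r → E) → T}
    (hφ : IsGrassmannPlucker φ) (i : Fin k → E) {w : Fin s → E}
    (hw : Tract.quotientBy h φ i w ≠ 0) : IsGrassmannPlucker (quotientBy h φ i) := by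
  have halt := hφ.isAlternating.quotientBy h i
  refine ⟨⟨_, w, rfl, hw⟩, ?_, halt.map_perm, halt.map_not_injective, ?_⟩
  · subst h
    refine exchangeProperty_of_exists_update halt fun b c l hb hc hl => ?_
    simp only [Tract.quotientBy, Fin.cast_refl, comp_id] at hb hc ⊢
    have hbi := hφ.isAlternating.injective hb
    have hl' : Fin.append i b (Fin.natAdd k l) ∉ Set.range (Fin.append i c) := by
      rintro ⟨z, hz⟩
      revert hz
      refine Fin.addCases (fun j hz => ?_) (fun j hz => ?_) z
      · rw [Fin.append_left, ← Fin.append_left i b, hbi.eq_iff] at hz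
        simp [Fin.ext_iff] at hz
        omega
      · rw [Fin.append_right, Fin.append_right] at hz
        exact hl ⟨j, hz⟩
    obtain ⟨t, ht, h⟩ := hφ.exists_update hb hc hl'
    revert ht h
    refine Fin.addCases (fun j ht h => ?_) (fun j ht h => ?_) t
    -- The new element is not an entry of `i`, since those already belong to the first base.
    · refine (ht ⟨Fin.castAdd s j, ?_⟩).elim
      simp
    · refine ⟨j, fun ⟨z, hz⟩ => ht ⟨Fin.natAdd k z, by simpa using hz⟩, ?_⟩
      rw [append_update]
      simpa using h
  · subst h
    intro m hm
    subst hm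
    intro x a b c d
    have := hφ.plucker (k + m) rfl (Fin.append i x) a b c d
    simpa [Tract.quotientBy, Fin.append_assoc] using this

omit [Tract T] in
lemma cons_eq_quotientBy (φ : (Fin (r + 1) → E) → T) (a : E) :
    (fun w => φ (Fin.cons a w)) = quotientBy (Nat.add_comm r 1) φ ![a] := by
  funext w
  simp only [quotientBy, Fin.append_left_eq_cons]
  rfl

lemma IsGrassmannPlucker.cons {φ : (Fin (r + 1) → E) → T} (hφ : IsGrassmannPlucker φ) {a : E}
    {w : Fin r → E} (hw : φ (Fin.cons a w) ≠ 0) :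
    IsGrassmannPlucker fun w => φ (Fin.cons a w) := by
  rw [cons_eq_quotientBy]
  refine hφ.quotientBy _ _ (w := w) ?_
  rwa [← cons_eq_quotientBy φ a]

lemma IsGrassmannPlucker.comap {F : Type*} {φ : (Fin r → E) → T} (hφ : IsGrassmannPlucker φ)
    {x : F → E} (hx : Injective x) {w : Fin r → F} (hw : φ (x ∘ w) ≠ 0) :
    IsGrassmannPlucker fun w : Fin r → F => φ (x ∘ w) := by
  have halt : IsAlternating fun w : Fin r → F => φ (x ∘ w) :=
    ⟨fun y σ => hφ.map_perm (x ∘ y) σ,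
      fun y hy => hφ.map_not_injective _ fun h => hy (Injective.of_comp h)⟩
  refine ⟨⟨_, w, rfl, hw⟩, ?_, halt.map_perm, halt.map_not_injective, ?_⟩
  · refine exchangeProperty_of_exists_update halt fun b c l hb hc hl => ?_
    obtain ⟨t, ht, h⟩ := hφ.exists_update hb hc (l := l)
      (fun ⟨z, hz⟩ => hl ⟨z, hx hz⟩)
    refine ⟨t, fun ⟨z, hz⟩ => ht ⟨z, congrArg x hz⟩, ?_⟩
    rwa [comp_update]
  · intro m hm y a b c d
    have key : ∀ u v, x ∘ (Fin.append y ![u, v] ∘ Fin.cast hm) =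
        Fin.append (x ∘ y) ![x u, x v] ∘ Fin.cast hm := by
      intro u v
      funext z
      simp only [comp_apply]
      generalize Fin.cast hm z = z
      refine Fin.addCases (fun j => ?_) (fun j => ?_) z
      · simp
      · fin_cases j <;> simp
    have := hφ.plucker m hm (x ∘ y) (x a) (x b) (x c) (x d)
    simpa only [key] using this

variable [Finite E]

lemma underlyingMatroid_isBase {φ : (Fin r → E) → T} (hφ : IsGrassmannPlucker φ) {B : Set E} :
    (underlyingMatroid φ hφ).IsBase B ↔ IsBaseOf φ B := by
  simp [underlyingMatroid]

/-- An independent set extends to a base inside the union with a given base. -/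
lemma IsGrassmannPlucker.exists_range_subset {φ : (Fin r → E) → T}
    (hφ : IsGrassmannPlucker φ) {I : Set E} {b : Fin r → E}
    (hI : (underlyingMatroid φ hφ).Indep I) (hb : φ b ≠ 0) :
    ∃ c, φ c ≠ 0 ∧ I ⊆ Set.range c ∧ Set.range c ⊆ I ∪ Set.range b := by
  obtain ⟨B, hB, h1, h2⟩ := hI.exists_isBase_subset_union_isBase
    ((underlyingMatroid_isBase hφ).2 ⟨b, rfl, hb⟩)
  obtain ⟨c, rfl, hc⟩ := (underlyingMatroid_isBase hφ).1 hB
  exact ⟨c, hc, h1, h2⟩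

lemma IsGrassmannPlucker.indep_iff {φ : (Fin r → E) → T} (hφ : IsGrassmannPlucker φ) {I : Set E} :
    (underlyingMatroid φ hφ).Indep I ↔ ∃ b, φ b ≠ 0 ∧ I ⊆ Set.range b := by
  rw [Matroid.indep_iff]
  constructor
  · rintro ⟨B, hB, h⟩
    obtain ⟨c, rfl, hc⟩ := (underlyingMatroid_isBase hφ).1 hB
    exact ⟨c, hc, h⟩
  · rintro ⟨b, hb, h⟩
    exact ⟨_, (underlyingMatroid_isBase hφ).2 ⟨b, rfl, hb⟩, h⟩

omit [Finite E] in
lemma cons_comp_swap {n : ℕ} (c : Fin (n + 1) → E) (j : Fin (n + 1)) :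
    c ∘ Equiv.swap 0 j = Fin.cons (c j) (Fin.tail (c ∘ Equiv.swap 0 j)) := by
  conv_lhs => rw [← Fin.cons_self_tail (c ∘ Equiv.swap 0 j)]
  simp

/-- An element of a base is not a loop, so elements of any other base complete it to a base. This
keeps a contraction nonzero after restriction to a set containing `b`. -/
lemma IsGrassmannPlucker.exists_cons_ne_zero {φ : (Fin (r + 1) → E) → T}
    (hφ : IsGrassmannPlucker φ) {b c : Fin (r + 1) → E} (hb : φ b ≠ 0) (hc : φ c ≠ 0)
    (j : Fin (r + 1)) :
    ∃ w : Fin r → E, φ (Fin.cons (c j) w) ≠ 0 ∧ ∀ l, w l ∈ Set.range b := by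
  obtain ⟨d, hd, h1, h2⟩ := hφ.exists_range_subset (I := {c j}) (b := b)
    (hφ.indep_iff.2 ⟨c, hc, by simp⟩) hb
  obtain ⟨p, hp⟩ := h1 rfl
  rw [← hφ.isAlternating.map_perm_ne_zero (Equiv.swap 0 p), cons_comp_swap, hp] at hd
  refine ⟨_, hd, fun l => ?_⟩
  have hinj := hφ.isAlternating.injective hd
  have h3 : Fin.tail (d ∘ Equiv.swap 0 p) l ∈ Set.range d := ⟨_, rfl⟩
  rcases h2 h3 with h | h
  · have := hinj (a₁ := l.succ) (a₂ := 0) (by simpa using h)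
    simp at this
  · exact h

end Minors

/-! ### Covectors of the dual function as solutions of Cramer's rule -/

section Duality

variable {T : Type*} [Tract T] {E : Type*} {r : ℕ}

lemma sign_sort_comp_perm {α : Type*} [LinearOrder α] {n : ℕ} {f : Fin n → α} (hf : Injective f)
    (σ : Equiv.Perm (Fin n)) :
    Equiv.Perm.sign (Tuple.sort (f ∘ σ)) = Equiv.Perm.sign σ * Equiv.Perm.sign (Tuple.sort f) := by
  have h : σ * Tuple.sort (f ∘ σ) = Tuple.sort f := by
    ext1 k
    exact hf (congrFun (Tuple.comp_perm_comp_sort_eq_comp_sort (f := f) (σ := σ)) k)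
  rw [← h, map_mul, ← mul_assoc, Int.units_mul_self, one_mul]

open scoped Classical in
/-- The function `dual φ` on tuples of an arbitrary length `p`. -/
noncomputable def dualOfLength [Fintype E] [LinearOrder E] (p : ℕ) (φ : (Fin r → E) → T) : (Fin p → E) → T :=
  fun d =>
    if h : ∃ e : Fin r → E, Bijective (Fin.append d e) then
      ofSign (Equiv.Perm.sign (Tuple.sort (Fin.append d h.choose))) * φ h.choose
    else 0

/-- With a free length, `p = m + 1` can be substituted, which the subtraction `Fintype.card E - r`
would obstruct. -/
lemma covectors_eq_vectors_dualOfLength [Fintype E] [LinearOrder E] (φ : (Fin r → E) → T) :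
    covectors φ = vectors (dualOfLength (Fintype.card E - r) φ) := rfl

lemma range_eq_of_bijective_append {p q : ℕ} {d : Fin p → E} {e e' : Fin q → E}
    (h : Bijective (Fin.append d e)) (h' : Bijective (Fin.append d e')) :
    Set.range e ⊆ Set.range e' := by
  rintro _ ⟨l, rfl⟩
  obtain ⟨k, hk⟩ := h'.2 (e l)
  revert hk
  refine Fin.addCases (fun j hk => ?_) (fun j hk => ?_) k
  · rw [Fin.append_left] at hk
    exact ((Fin.append_injective_iff.1 h.1).2.2 j l hk).elim
  · exact ⟨j, by simpa using hk⟩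

lemma dualOfLength_eq [Fintype E] [LinearOrder E] {p : ℕ} {φ : (Fin r → E) → T} (hφ : IsAlternating φ)
    {d : Fin p → E} {e : Fin r → E} (h : Bijective (Fin.append d e)) :
    dualOfLength p φ d = ofSign (Equiv.Perm.sign (Tuple.sort (Fin.append d e))) * φ e := by
  have hex : ∃ e : Fin r → E, Bijective (Fin.append d e) := ⟨e, h⟩
  have h' := hex.choose_spec
  rw [dualOfLength, dif_pos hex]
  obtain ⟨σ, hσ⟩ := exists_perm_of_range_eq (Fin.append_injective_iff.1 h.1).2.1
    (Fin.append_injective_iff.1 h'.1).2.1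
    ((range_eq_of_bijective_append h h').antisymm (range_eq_of_bijective_append h' h))
  rw [hσ, append_comp_perm, sign_sort_comp_perm h.1, hφ.map_perm, Equiv.Perm.sign_permCongr,
    Equiv.Perm.sign_sumCongr, ← mul_assoc, ← ofSign_mul]
  congr 2
  rw [Equiv.Perm.sign_one, one_mul, mul_right_comm, Int.units_mul_self, one_mul]

lemma dualOfLength_eq_zero [Fintype E] [LinearOrder E] {p : ℕ} {φ : (Fin r → E) → T} {d : Fin p → E}
    (h : ¬ Injective d) : dualOfLength p φ d = 0 := by
  rw [dualOfLength, dif_neg]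
  rintro ⟨e, he⟩
  exact h (Fin.append_injective_iff.1 he.1).1

/-- Reindex the sum by the enumeration (i, e, b). Terms at entries of i vanish by repetition; the
term at b_l interchanges e and b_l in the enumeration, and this transposition gives the minus sign
of Cramer's rule. -/
lemma sumNull_dual_iff_cramer [Fintype E] [LinearOrder E] {m : ℕ} {φ : (Fin r → E) → T}
    (hφ : IsAlternating φ) (X : E → T) {i : Fin m → E} {b : Fin r → E} {e : E}
    (h : Bijective (Fin.append (Fin.snoc i e : Fin (m + 1) → E) b)) :
    SumNull (fun z => X z * dualOfLength (m + 1) φ (Fin.snoc i z)) ↔ Cramer φ X b e := by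
  unfold SumNull Cramer
  rw [← Equiv.sum_comp (Equiv.ofBijective _ h)]
  simp only [Equiv.ofBijective_apply]
  rw [Fin.sum_univ_add, Fin.sum_univ_castSucc, Finset.sum_eq_zero, zero_add]
  · simp only [Fin.append_left, Fin.append_right, Fin.snoc_last]
    rw [dualOfLength_eq hφ h]
    set ε := Equiv.Perm.sign (Tuple.sort (Fin.append (Fin.snoc i e : Fin (m + 1) → E) b))
    have key : ∀ l, dualOfLength (m + 1) φ (Fin.snoc i (b l)) =
        neg (ofSign ε * φ (update b l e)) := by
      intro l
      have hne : Fin.castAdd r (Fin.last m) ≠ Fin.natAdd (m + 1) l := by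
        simp [Fin.ext_iff]
        omega
      have h1 : Fin.append (Fin.snoc i (b l) : Fin (m + 1) → E) (update b l e) =
          Fin.append (Fin.snoc i e : Fin (m + 1) → E) b ∘
            Equiv.swap (Fin.castAdd r (Fin.last m)) (Fin.natAdd (m + 1) l) := by
        funext k
        refine Fin.addCases (fun j => ?_) (fun j => ?_) k
        · refine Fin.lastCases ?_ (fun j => ?_) j
          · simp
          · rw [comp_apply, Equiv.swap_apply_of_ne_of_ne]
            · simp
            · simp [Fin.ext_iff]
              omega
            · simp [Fin.ext_iff]
              omega
        · by_cases hj : j = l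
          · subst hj
            simp
          · rw [comp_apply, Equiv.swap_apply_of_ne_of_ne]
            · simp [hj]
            · simp [Fin.ext_iff]
              omega
            · simpa using hj
      rw [dualOfLength_eq hφ (e := update b l e), h1, sign_sort_comp_perm h.1,
        Equiv.Perm.sign_swap hne, neg_mul, one_mul, ofSign_neg_mul]
      rw [h1]
      exact h.comp (Equiv.bijective _)
    simp only [key, mul_neg', mul_left_comm (X _) (ofSign ε)]
    simp only [← mul_neg', ambient_mul (ofSign ε), ← Finset.mul_sum, ← mul_add]
    exact ambient_mul_mem_iff (ofSign_ne_zero ε)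
  · intro k _
    rw [dualOfLength_eq_zero]
    · simp
    · intro hinj
      have := hinj (a₁ := k.castSucc) (a₂ := Fin.last m) (by simp)
      exact absurd this (Fin.castSucc_lt_last k).ne

lemma exists_bijective_append [Fintype E] {p q : ℕ} {d : Fin p → E} (hd : Injective d)
    (hcard : p + q = Fintype.card E) : ∃ e : Fin q → E, Bijective (Fin.append d e) := by
  classical
  have h1 : Fintype.card {z // z ∉ Set.range d} = q := by
    have := Fintype.card_subtype_compl (fun z => z ∈ Set.range d)
    have h2 : Fintype.card {z // z ∈ Set.range d} = p := by
      rw [← Fintype.card_congr (Equiv.ofInjective d hd), Fintype.card_fin]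
    omega
  let f := (Fintype.equivFinOfCardEq h1).symm
  refine ⟨fun l => f l, (Fintype.bijective_iff_injective_and_card _).2 ⟨?_, by simpa using hcard⟩⟩
  refine Fin.append_injective_iff.2 ⟨hd, fun a b hab => f.injective (Subtype.ext hab), ?_⟩
  intro i j h
  exact (f j).2 ⟨i, h⟩

lemma mem_vectors_dualOfLength_iff [Fintype E] [LinearOrder E] {p : ℕ}
    {φ : (Fin r → E) → T} (hφ : IsAlternating φ) (hp : p + r = Fintype.card E) (X : E → T) :
    X ∈ vectors (dualOfLength p φ) ↔ IsCovector φ X := by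
  constructor
  · intro h
    refine isCovector_of_ne_zero hφ fun b e hb => ?_
    have hinj := hφ.injective hb
    by_cases he : e ∈ Set.range b
    · obtain ⟨s, rfl⟩ := he
      exact cramer_mem hφ X b s
    have hinj' : Injective (Fin.cons e b : Fin (r + 1) → E) :=
      Fin.cons_injective_iff.2 ⟨he, hinj⟩
    -- The r + 1 distinct entries of (e, b) force r < card E, so p is positive.
    obtain ⟨m, rfl⟩ : ∃ m, p = m + 1 := by
      have := Fintype.card_le_of_injective _ hinj'
      simp only [Fintype.card_fin] at this
      exact ⟨p - 1, by omega⟩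
    obtain ⟨i, hi⟩ := exists_bijective_append (q := m) hinj' (by omega)
    obtain ⟨-, h2, h3⟩ := Fin.append_injective_iff.1 hi.1
    refine (sumNull_dual_iff_cramer hφ X (i := i) ?_).1 (h m rfl i)
    refine (Fintype.bijective_iff_injective_and_card _).2 ⟨?_, by simpa using hp⟩
    refine Fin.append_injective_iff.2 ⟨Fin.snoc_injective_iff.2 ⟨h2, ?_⟩, hinj, ?_⟩
    · rintro ⟨j, hj⟩
      exact h3 0 j (by simpa using hj.symm)
    · intro j l hjl
      revert hjl
      refine Fin.lastCases ?_ (fun j => ?_) j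
      · intro hjl
        exact he ⟨l, by simpa using hjl.symm⟩
      · intro hjl
        exact h3 l.succ j (by simpa using hjl.symm)
  · intro h m hm i
    subst hm
    simp only [Fin.cast_refl, comp_id]
    by_cases hi : Injective i
    · obtain ⟨c, hc⟩ := exists_bijective_append (q := r + 1) hi (by omega)
      obtain ⟨-, h2, h3⟩ := Fin.append_injective_iff.1 hc.1
      refine (sumNull_dual_iff_cramer hφ X (e := c 0) (b := Fin.tail c) ?_).2 (h _ _)
      refine (Fintype.bijective_iff_injective_and_card _).2 ⟨?_, by simpa using hp⟩
      refine Fin.append_injective_iff.2 ⟨Fin.snoc_injective_iff.2 ⟨hi, ?_⟩,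
        h2.comp (Fin.succ_injective r), ?_⟩
      · rintro ⟨j, hj⟩
        exact h3 j 0 hj
      · intro j l
        refine Fin.lastCases ?_ (fun j => ?_) j
        · intro hjl
          exact Fin.succ_ne_zero l (h2 (by simpa [Fin.tail] using hjl)).symm
        · intro hjl
          exact h3 j l.succ (by simpa [Fin.tail] using hjl)
    · have : ∀ z, dualOfLength (m + 1) φ (Fin.snoc i z : Fin (m + 1) → E) = 0 := fun z =>
        dualOfLength_eq_zero fun h => hi (Fin.snoc_injective_iff.1 h).1
      simp [SumNull, this]

lemma mem_covectors_iff [Fintype E] [LinearOrder E] {φ : (Fin r → E) → T}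
    (hφ : IsGrassmannPlucker φ) {X : E → T} : X ∈ covectors φ ↔ IsCovector φ X := by
  rw [covectors_eq_vectors_dualOfLength]
  refine mem_vectors_dualOfLength_iff hφ.isAlternating (Nat.sub_add_cancel ?_) X
  obtain ⟨_, b, -, hb⟩ := hφ.exists_base
  simpa using Fintype.card_le_of_injective _ (hφ.isAlternating.injective hb)

end Duality

/-! ### Perfection and the general Plücker relations -/

section Perfect

variable {T : Type*} [Tract T] {E : Type*} {r : ℕ}

/-- The bijection with `Fin n` need not respect the order of `E`; this is harmless because
`IsCovector` does not involve an order. -/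
lemma orth_of_isPerfect (hT : IsPerfect T) [Fintype E] {φ : (Fin r → E) → T}
    (hφ : IsGrassmannPlucker φ) {X Y : E → T} (hX : X ∈ vectors φ) (hY : IsCovector φ Y) :
    Orth X Y := by
  let f := (Fintype.equivFin E).symm
  obtain ⟨_, b, -, hb⟩ := hφ.exists_base
  have hψ : IsGrassmannPlucker fun w : Fin r → Fin (Fintype.card E) => φ (f ∘ w) := by
    refine hφ.comap f.injective (w := f.symm ∘ b) ?_
    rwa [← comp_assoc, Equiv.self_comp_symm, id_comp]
  have hX' : X ∘ f ∈ vectors fun w : Fin r → Fin (Fintype.card E) => φ (f ∘ w) := by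
    intro m h i
    rw [← sumNull_comp_equiv f.symm]
    convert hX m h (f ∘ i) using 4 with e
    · simp
    · rw [← comp_assoc, Fin.comp_snoc, Equiv.apply_symm_apply]
  have hY' : Y ∘ f ∈ covectors fun w : Fin r → Fin (Fintype.card E) => φ (f ∘ w) := by
    rw [mem_covectors_iff hψ]
    intro β ε
    have := hY (f ∘ β) (f ε)
    simpa only [Cramer, comp_update, comp_apply] using this
  exact (sumNull_comp_equiv f fun e => X e * Y e).1 (hT _ _ _ hψ _ hX' _ hY')

variable {φ : (Fin r → E) → T}

lemma Cramer.const_mul {X : E → T} {b : Fin r → E} {e : E} (h : Cramer φ X b e) (a : T) :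
    Cramer φ (fun z => a * X z) b e := by
  have := ambient_mul_mem a h
  rw [mul_add, Finset.mul_sum] at this
  simpa only [Cramer, ← ambient_mul, mul_neg', mul_assoc] using this

lemma cramer_of_eq_zero {X : E → T} {b : Fin r → E} {e : E} (he : X e = 0)
    (hb : ∀ l, X (b l) = 0) : Cramer φ X b e := by
  simp [Cramer, he, hb]

lemma cramer_iff_sumNull (X : E → T) (b : Fin r → E) (e : E) :
    Cramer φ X b e ↔
      SumNull fun l => (Fin.cons (φ b) fun l => neg (φ (update b l e)) : Fin (r + 1) → T) l *
        X ((Fin.cons e b : Fin (r + 1) → E) l) := by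
  simp [SumNull, Cramer, Fin.sum_univ_succ, mul_neg', mul_comm]

/-- The Plücker relations between `(c_1, …, e, …, c_r)` and `(b_1, …, b_r)` may be checked
after moving any given entry of `c` to the front. -/
lemma cramer_of_cons {φ : (Fin (r + 1) → E) → T} (hφ : IsAlternating φ) (c b : Fin (r + 1) → E)
    (e : E) {j t : Fin (r + 1)} (hj : j ≠ t)
    (H : ∀ c' t', Cramer φ (fun z => φ (Fin.cons (c j) (update c' t' z))) b e) :
    Cramer φ (fun z => φ (update c t z)) b e := by
  set τ := Equiv.swap 0 j
  have ht : τ t ≠ 0 := by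
    intro h
    rw [Equiv.swap_apply_eq_iff, Equiv.swap_apply_left] at h
    exact hj h.symm
  obtain ⟨t', ht'⟩ := Fin.exists_succ_eq.2 ht
  have key : ∀ z, φ (update c t z) = ofSign (Equiv.Perm.sign τ) *
      φ (Fin.cons (c j) (update (Fin.tail (c ∘ τ)) t' z)) := by
    intro z
    rw [← hφ.map_perm, Fin.cons_update, ← cons_comp_swap, ht', ← update_comp_perm, comp_assoc,
      ← Equiv.coe_trans]
    simp [τ, ← Equiv.Perm.mul_def]
  simp only [key]
  exact (H _ _).const_mul _

/-- The term that replaces the leading k of the second tuple has the factor φ(k, …, k, …) = 0; what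
remains is the relation for the contraction at k. -/
lemma cramer_cons_cons {φ : (Fin (r + 1) → E) → T} (hφ : IsAlternating φ) {k : E}
    {c b : Fin r → E} {e : E} {t : Fin r}
    (h : Cramer (fun w => φ (Fin.cons k w)) (fun z => φ (Fin.cons k (update c t z))) b e) :
    Cramer φ (fun z => φ (Fin.cons k (update c t z))) (Fin.cons k b) e := by
  have h0 : φ (Fin.cons k (update c t k)) = 0 :=
    hφ.eq_zero (Fin.succ_ne_zero t).symm (by simp)
  unfold Cramer at h ⊢
  rw [Fin.sum_univ_succ]
  simpa [h0, ← Fin.cons_update] using h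

/-- The common element is moved to the front of both tuples and contracted, which lowers the rank.
If it is e itself, an exchange first brings it into b. -/
lemma cramer_of_mem_range {φ : (Fin (r + 1) → E) → T} (hφ : IsGrassmannPlucker φ)
    (ih : ∀ ψ : (Fin r → E) → T, IsGrassmannPlucker ψ → ∀ c t,
      IsCovector ψ fun z => ψ (update c t z))
    (c b : Fin (r + 1) → E) (e : E) {j t : Fin (r + 1)} (hj : j ≠ t)
    (h : c j ∈ Set.range (Fin.cons e b : Fin (r + 2) → E)) :
    Cramer φ (fun z => φ (update c t z)) b e := by
  have halt := hφ.isAlternating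
  have main : ∀ b e, c j ∈ Set.range b → Cramer φ (fun z => φ (update c t z)) b e := by
    rintro b e ⟨s, hs⟩
    refine cramer_of_cons halt c b e hj fun c' t' => ?_
    rw [← cramer_perm halt _ _ _ (Equiv.swap 0 s), cons_comp_swap, hs]
    by_cases hw : ∃ w : Fin r → E, φ (Fin.cons (c j) w) ≠ 0
    · obtain ⟨w, hw⟩ := hw
      exact cramer_cons_cons halt (ih _ (hφ.cons hw) c' t' _ e)
    · push Not at hw
      exact cramer_of_eq_zero (hw _) fun _ => hw _
  rw [Fin.range_cons] at h
  rcases h with h | h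
  · exact cramer_exchange halt 0 (main _ _ ⟨0, by simp [h]⟩)
  · exact main b e h

/-- The Plücker relations for a Grassmann-Plücker function of rank `1`. -/
lemma cramer_rank_one {φ : (Fin 1 → E) → T} (c : Fin 1 → E) (t : Fin 1) (b : Fin 1 → E) (e : E) :
    Cramer φ (fun z => φ (update c t z)) b e := by
  have key : ∀ (c : Fin 1 → E) (t : Fin 1) z, update c t z = fun _ => z := by
    intro c t z
    funext k
    rw [Subsingleton.elim k t, update_self]
  have hb : b = fun _ => b 0 := by
    funext k
    rw [Subsingleton.elim k 0]
  simp only [Cramer, key, Finset.univ_unique, Finset.sum_singleton, Fin.default_eq_zero]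
  rw [← hb, mul_comm]
  exact ambient_add_neg _

/-- The Plücker relations for a Grassmann-Plücker function of rank `2`. -/
lemma cramer_rank_two {φ : (Fin 2 → E) → T} (hφ : IsGrassmannPlucker φ) (c : Fin 2 → E)
    (t : Fin 2) (b : Fin 2 → E) (e : E) : Cramer φ (fun z => φ (update c t z)) b e := by
  obtain ⟨j, hj⟩ := exists_ne t
  refine cramer_of_cons hφ.isAlternating c b e hj fun c' t' => ?_
  generalize c j = a
  -- This is Cramer's rule once φ(b_0, e) is rewritten as -φ(e, b_0).
  have h := hφ.plucker 0 rfl ![] a e (b 0) (b 1)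
  have key : ∀ u v, Fin.append (![] : Fin 0 → E) ![u, v] ∘ Fin.cast rfl = ![u, v] := by
    intro u v
    funext k
    fin_cases k <;> rfl
  have h1 : ∀ z, (Fin.cons a (update c' t' z) : Fin 2 → E) = ![a, z] := by
    intro z
    funext k
    refine Fin.cases rfl (fun k => ?_) k
    rw [Fin.cons_succ, Subsingleton.elim k t', update_self, Subsingleton.elim t' 0]
    rfl
  have h2 : b = ![b 0, b 1] := by
    funext k
    fin_cases k <;> rfl
  have h3 : update b 0 e = ![e, b 1] := by
    funext k
    fin_cases k <;> rfl
  have h4 : update b 1 e = ![e, b 0] ∘ Equiv.swap 0 1 := by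
    funext k
    fin_cases k <;> rfl
  simp only [key] at h
  unfold Cramer
  rw [Fin.sum_univ_two, h3, h4, hφ.isAlternating.map_swap _ (by decide), mul_neg', neg_neg',
    ← add_assoc]
  simp only [h1]
  rw [← h2] at h
  exact h

/-- Over a perfect tract, the 3-term Plücker relations imply all Plücker relations: cocircuits are
orthogonal to circuits. -/
theorem isCovector_cocircuit (hT : IsPerfect T) [Finite E] : ∀ {r : ℕ} (φ : (Fin r → E) → T),
    IsGrassmannPlucker φ → ∀ c t, IsCovector φ fun z => φ (update c t z)
  | 0, _, _, _, t => t.elim0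
  | 1, _, _, c, t => cramer_rank_one c t
  | 2, _, hφ, c, t => cramer_rank_two hφ c t
  | r + 3, φ, hφ, c, t => by
    have ih : ∀ ψ : (Fin (r + 2) → E) → T, IsGrassmannPlucker ψ → ∀ c t,
      IsCovector ψ fun z => ψ (update c t z) := isCovector_cocircuit hT
    have halt := hφ.isAlternating
    obtain ⟨j, hj⟩ := exists_ne t
    refine isCovector_of_ne_zero halt fun b e hb => ?_
    by_cases he : e ∈ Set.range b
    · obtain ⟨s, rfl⟩ := he
      exact cramer_mem halt _ b s
    refine cramer_of_cons halt c b e hj fun c' t' => ?_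
    generalize c j = a
    set x : Fin (r + 4) → E := Fin.cons e b with hx
    have hinj : Injective x := Fin.cons_injective_iff.2 ⟨he, halt.injective hb⟩
    by_cases hz : ∃ z, φ (Fin.cons a (update c' t' z)) ≠ 0
    swap
    · push Not at hz
      exact cramer_of_eq_zero (hz _) fun _ => hz _
    obtain ⟨z, hz⟩ := hz
    -- This base through a, completed from b, shows that the contraction at a remains nonzero on b ∪
    -- {e}.
    obtain ⟨w, hw, hwb⟩ := hφ.exists_cons_ne_zero hb hz 0
    rw [Fin.cons_zero] at hw
    choose w' hw' using hwb
    have hN : IsGrassmannPlucker fun w : Fin (r + 2) → Fin (r + 4) => φ (Fin.cons a (x ∘ w)) := by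
      refine (hφ.cons hw).comap hinj (w := fun l => (w' l).succ) ?_
      convert hw using 3
      funext l
      simp [hx, hw']
    rw [cramer_iff_sumNull]
    refine orth_of_isPerfect hT hN (Y := fun l => φ (Fin.cons a (update c' t' (x l)))) ?_ ?_
    · intro m hm i
      obtain rfl : m = r + 1 := by omega
      have key := cramer_of_mem_range hφ ih (Fin.cons a (Fin.snoc (x ∘ i) a)) b e
        (j := (Fin.castSucc 0).succ) (t := (Fin.last _).succ) (by simp [Fin.ext_iff])
        (by rw [Fin.cons_succ, Fin.snoc_castSucc]; exact ⟨i 0, rfl⟩)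
      rw [cramer_iff_sumNull] at key
      simpa only [← Fin.cons_update, Fin.update_snoc_last, Fin.comp_snoc, Fin.cast_refl,
        comp_id] using key
    · intro β ε
      -- The cocircuit is a covector of the contraction at a by induction, and hence of its
      -- restriction.
      have key := ih _ (hφ.cons hw) c' t' (x ∘ β) (x ε)
      simpa only [Cramer, comp_update, comp_apply] using key

end Perfect

/-! ### Support bases, normal forms and dimension of the covector set -/

section LinearSubspace

variable {T : Type*} [Tract T] {E : Type*} {r : ℕ} {φ : (Fin r → E) → T}

lemma eq_of_ambient_add_neg_mem {a b : T} (h : ambient a + ambient (neg b) ∈ nullset) : a = b := by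
  rw [← neg_neg' a, ← eq_neg_of_mem h, neg_neg']

lemma Cramer.apply_mul_eq_zero {X : E → T} {b : Fin r → E} {e : E} (h : Cramer φ X b e)
    (hX : ∀ l, X (b l) * φ (update b l e) = 0) : X e * φ b = 0 := by
  refine eq_zero_of_ambient_mem ?_
  simpa [Cramer, hX] using h

lemma Cramer.apply_mul_eq {X : E → T} {b : Fin r → E} {e : E} (h : Cramer φ X b e) (t : Fin r)
    (hX : ∀ l ≠ t, X (b l) = 0) : X e * φ b = X (b t) * φ (update b t e) := by
  refine eq_of_ambient_add_neg_mem ?_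
  unfold Cramer at h
  rwa [Finset.sum_eq_single t (fun l _ hl => by simp [hX l hl]) (by simp)] at h

/-- The normalized cocircuit with value `1` at `b_l` that vanishes at the other entries of `b`. -/
noncomputable def cocircuit (φ : (Fin r → E) → T) (b : Fin r → E) (l : Fin r) (e : E) : T :=
  (φ b)⁻¹ * φ (update b l e)

lemma cocircuit_self {b : Fin r → E} (hb : φ b ≠ 0) (l : Fin r) : cocircuit φ b l (b l) = 1 := by
  simp [cocircuit, hb]

lemma cocircuit_of_ne (hφ : IsAlternating φ) {b : Fin r → E} {l t : Fin r} (h : t ≠ l) :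
    cocircuit φ b l (b t) = 0 := by
  rw [cocircuit, hφ.eq_zero (b := update b l (b t)) h (by simp [h]), mul_zero]

/-- The covectors, described by orthogonality to the circuits. -/
def covectorSet (φ : (Fin r → E) → T) : Set (E → T) := {X | IsCovector φ X}

lemma cramer_iff_span {b : Fin r → E} (hb : φ b ≠ 0) {X : E → T} {e : E} :
    Cramer φ X b e ↔ ambient (X e) + ∑ l, ambient (neg (X (b l) * cocircuit φ b l e)) ∈
      (nullset : Ideal (MonoidAlgebra ℕ Tˣ)) := by
  rw [Cramer, ← ambient_mul_mem_iff (inv_ne_zero hb), mul_add, Finset.mul_sum]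
  simp only [← ambient_mul, mul_neg', cocircuit, mul_left_comm (φ b)⁻¹]
  rw [inv_mul_cancel₀ hb, mul_one]

variable [Fintype E]

lemma cocircuit_mem (hT : IsPerfect T) (hφ : IsGrassmannPlucker φ) (b : Fin r → E) (l : Fin r) :
    cocircuit φ b l ∈ covectorSet φ :=
  fun b' e => (isCovector_cocircuit hT φ hφ b l b' e).const_mul _

omit [Fintype E] in
-- With a single nonzero value on the base, only two terms of Cramer's rule survive and it can be
-- solved for `X e`. Hence the normal form on a base is unique.
lemma eq_cocircuit {b : Fin r → E} (hb : φ b ≠ 0) {X : E → T}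
    (hX : X ∈ covectorSet φ) {l : Fin r} (h1 : X (b l) = 1) (h0 : ∀ t ≠ l, X (b t) = 0) (e : E) :
    X e = cocircuit φ b l e := by
  have := (hX b e).apply_mul_eq l h0
  rw [h1, one_mul] at this
  rw [cocircuit, ← this, mul_comm, mul_inv_cancel_right₀ hb]

/-- A base `b` maximizing the intersection with `C`. -/
lemma IsGrassmannPlucker.exists_max (hφ : IsGrassmannPlucker φ) (C : Finset E) :
    ∃ b, φ b ≠ 0 ∧ ∀ l, b l ∉ C → ∀ c ∈ C, φ (update b l c) = 0 := by
  classical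
  obtain ⟨_, b₀, -, hb₀⟩ := hφ.exists_base
  obtain ⟨b, hb, hmax⟩ := Finset.exists_max_image
    (Finset.univ.filter fun b : Fin r → E => φ b ≠ 0)
    (fun b => (Finset.univ.filter fun l => b l ∈ C).card) ⟨b₀, by simpa using hb₀⟩
  refine ⟨b, by simpa using hb, fun l hl c hc => ?_⟩
  by_contra h
  refine absurd (hmax (update b l c) (by simpa using h)) (not_le.2 (Finset.card_lt_card ?_))
  refine Finset.ssubset_iff_subset_ne.2 ⟨fun k hk => ?_, fun heq => ?_⟩
  · simp only [Finset.mem_filter, Finset.mem_univ, true_and] at hk ⊢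
    rw [update_of_ne]
    · exact hk
    · rintro rfl
      exact hl hk
  · have : l ∈ Finset.univ.filter fun l => b l ∈ C := by
      rw [heq]
      simpa using hc
    exact hl (by simpa using this)

variable [DecidableEq E]

omit [Fintype E] in
lemma meets_image {b : Fin r → E} (hb : φ b ≠ 0) {X : E → T}
    (hX : X ∈ covectorSet φ) (h0 : X ≠ 0) : ∃ e ∈ Finset.univ.image b, X e ≠ 0 := by
  by_contra! h
  refine h0 (funext fun e => ?_)
  have := (hX b e).apply_mul_eq_zero fun l => by rw [h (b l) (by simp), zero_mul]
  exact (mul_eq_zero.1 this).resolve_right hb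

/-- Choose b with the largest intersection with C. If b_l ∉ C, the cocircuit of b at b_l vanishes on
C by maximality, although it is nonzero. -/
lemma exists_image_subset (hT : IsPerfect T) (hφ : IsGrassmannPlucker φ) {C : Finset E}
    (hC : ∀ X ∈ covectorSet φ, X ≠ 0 → ∃ e ∈ C, X e ≠ 0) :
    ∃ b, φ b ≠ 0 ∧ Finset.univ.image b ⊆ C := by
  obtain ⟨b, hb, hmax⟩ := hφ.exists_max C
  refine ⟨b, hb, fun z hz => ?_⟩
  obtain ⟨l, -, rfl⟩ := Finset.mem_image.1 hz
  by_contra hl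
  obtain ⟨e, he, h⟩ := hC _ (cocircuit_mem hT hφ b l) fun h0 => by
    have := congrFun h0 (b l)
    rw [cocircuit_self hb] at this
    exact one_ne_zero this
  exact h (by rw [cocircuit, hmax l hl e he, mul_zero])

lemma isSupportBasis_iff (hT : IsPerfect T) (hφ : IsGrassmannPlucker φ) {B : Finset E} :
    IsSupportBasis (covectorSet φ) B ↔ ∃ b, φ b ≠ 0 ∧ Finset.univ.image b = B := by
  constructor
  · intro h
    obtain ⟨b, hb, hB⟩ := exists_image_subset hT hφ h.prop
    exact ⟨b, hb, hB.antisymm (h.le_of_le (fun X hX h0 => meets_image hb hX h0) hB)⟩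
  · rintro ⟨b, hb, rfl⟩
    refine ⟨fun X hX h0 => meets_image hb hX h0, fun C hC hCb => ?_⟩
    obtain ⟨c, hc, hcC⟩ := exists_image_subset hT hφ hC
    have hcard : ∀ d, φ d ≠ 0 → (Finset.univ.image d).card = r := fun d hd => by
      rw [Finset.card_image_of_injective _ (hφ.isAlternating.injective hd), Finset.card_fin]
    have := Finset.eq_of_subset_of_card_le (hcC.trans hCb) (by rw [hcard b hb, hcard c hc])
    exact this ▸ hcC

omit [Fintype E] in
lemma sum_image_subtype {M : Type*} [AddCommMonoid M] {b : Fin r → E} (hb : Injective b)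
    (f : ↥(Finset.univ.image b) → M) :
    ∑ a, f a = ∑ l, f ⟨b l, Finset.mem_image_of_mem b (Finset.mem_univ l)⟩ := by
  symm
  refine Fintype.sum_bijective
    (fun l => (⟨b l, Finset.mem_image_of_mem b (Finset.mem_univ l)⟩ :
      ↥(Finset.univ.image b))) ⟨fun i j h => hb (congrArg Subtype.val h), ?_⟩ _ _
    fun _ => rfl
  rintro ⟨z, hz⟩
  obtain ⟨l, -, rfl⟩ := Finset.mem_image.1 hz
  exact ⟨l, rfl⟩

lemma exists_isNormalForm (hT : IsPerfect T) (hφ : IsGrassmannPlucker φ) {b : Fin r → E}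
    (hb : φ b ≠ 0) : ∃ S, IsNormalForm (covectorSet φ) (Finset.univ.image b) S := by
  have h : ∀ i : ↥(Finset.univ.image b), ∃ l, b l = i := fun i => by
    obtain ⟨l, -, hl⟩ := Finset.mem_image.1 i.2
    exact ⟨l, hl⟩
  choose g hg using h
  refine ⟨fun i => cocircuit φ b (g i), fun i => cocircuit_mem hT hφ b _, fun i j => ?_⟩
  rw [← hg j]
  split_ifs with hij
  · subst hij
    exact cocircuit_self hb _
  · refine cocircuit_of_ne hφ.isAlternating fun h => hij ?_
    rw [Subtype.ext_iff, ← hg i, ← hg j, h]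

omit [Fintype E] in
-- The normal form is forced to consist of cocircuits, so its span condition is Cramer's rule
-- divided by `φ b`. At entries of b, where the span imposes nothing, Cramer's rule is automatic.
lemma mem_span_iff (hφ : IsGrassmannPlucker φ) {b : Fin r → E}
    (hb : φ b ≠ 0) {S : ↥(Finset.univ.image b) → E → T}
    (hS : IsNormalForm (covectorSet φ) (Finset.univ.image b) S) {X : E → T} :
    X ∈ span (Finset.univ.image b) S ↔ ∀ e, Cramer φ X b e := by
  have hinj := hφ.isAlternating.injective hb
  have hval : ∀ l e, S ⟨b l, Finset.mem_image_of_mem b (Finset.mem_univ l)⟩ e =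
      cocircuit φ b l e := by
    intro l e
    refine eq_cocircuit hb (hS.1 _) ?_ (fun t ht => ?_) e
    · simpa using hS.2 ⟨b l, by simp⟩ ⟨b l, by simp⟩
    · simpa [hinj.eq_iff, ht.symm] using hS.2 ⟨b l, by simp⟩ ⟨b t, by simp⟩
  have key : ∀ e, ambient (X e) + ∑ a : ↥(Finset.univ.image b),
      ambient (neg (X a * S a e)) ∈ (nullset : Ideal (MonoidAlgebra ℕ Tˣ)) ↔ Cramer φ X b e := by
    intro e
    rw [cramer_iff_span hb, sum_image_subtype hinj]
    simp only [hval]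
  constructor
  · intro h e
    by_cases he : e ∈ Finset.univ.image b
    · obtain ⟨l, -, rfl⟩ := Finset.mem_image.1 he
      exact cramer_mem hφ.isAlternating X b l
    · exact (key e).1 (h e he)
  · exact fun h e _ => (key e).2 (h e)

omit [DecidableEq E] in
lemma isLinearSubspace_covectorSet (hT : IsPerfect T) (hφ : IsGrassmannPlucker φ) :
    IsLinearSubspace (covectorSet φ) := by
  classical
  refine ⟨fun a X hX b e => (hX b e).const_mul a, Set.ext fun X => ⟨?_, ?_⟩⟩
  · rintro hX B S hB hS
    obtain ⟨b, hb, rfl⟩ := (isSupportBasis_iff hT hφ).1 hB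
    exact (mem_span_iff hφ hb hS).2 fun e => hX b e
  · intro hX
    refine isCovector_of_ne_zero hφ.isAlternating fun b e hb => ?_
    obtain ⟨S, hS⟩ := exists_isNormalForm hT hφ hb
    exact (mem_span_iff hφ hb hS).1
      (hX _ S ((isSupportBasis_iff hT hφ).2 ⟨b, hb, rfl⟩) hS) e

/-- Choose b with the largest intersection with J and suppose j ∈ J is not in b. In Cramer's rule
for S_j at b and j, entries of b in J give S_j(b_l) = 0 and the others give no base by maximality,
so S_j(j) = 0, against S_j(j) = 1. -/
lemma IsNormalForm.exists_subset_image (hφ : IsGrassmannPlucker φ) {J : Finset E}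
    {S : J → E → T} (hS : IsNormalForm (covectorSet φ) J S) :
    ∃ b, φ b ≠ 0 ∧ J ⊆ Finset.univ.image b := by
  obtain ⟨b, hb, hmax⟩ := hφ.exists_max J
  refine ⟨b, hb, fun j hj => ?_⟩
  by_contra hjb
  have h := (hS.1 ⟨j, hj⟩ b j).apply_mul_eq_zero fun l => ?_
  · have h1 : S ⟨j, hj⟩ j = 1 := by simpa using hS.2 ⟨j, hj⟩ ⟨j, hj⟩
    rw [h1, one_mul] at h
    exact hb h
  · by_cases hl : b l ∈ J
    · have h0 : S ⟨j, hj⟩ (b l) = 0 := by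
        have hne : j ≠ b l := fun h => hjb (by simp [h])
        simpa [hne] using hS.2 ⟨j, hj⟩ ⟨b l, hl⟩
      rw [h0, zero_mul]
    · rw [hmax l hl j hj, mul_zero]

omit [DecidableEq E] in
lemma hasDimension_covectorSet (hT : IsPerfect T) (hφ : IsGrassmannPlucker φ) :
    HasDimension (covectorSet φ) r := by
  classical
  have hcard : ∀ d, φ d ≠ 0 → (Finset.univ.image d).card = r := fun d hd => by
    rw [Finset.card_image_of_injective _ (hφ.isAlternating.injective hd), Finset.card_fin]
  obtain ⟨_, b, -, hb⟩ := hφ.exists_base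
  refine ⟨⟨Finset.univ.image b, exists_isNormalForm hT hφ hb, ?_⟩, ?_⟩
  · rintro J ⟨S, hS⟩ hbJ
    obtain ⟨c, hc, hJ⟩ := hS.exists_subset_image hφ
    have := Finset.eq_of_subset_of_card_le (hbJ.trans hJ) (by rw [hcard b hb, hcard c hc])
    exact this ▸ hJ
  · rintro J ⟨⟨S, hS⟩, hmax⟩
    obtain ⟨c, hc, hJ⟩ := hS.exists_subset_image hφ
    rw [hJ.antisymm (hmax (exists_isNormalForm hT hφ hc) hJ), hcard c hc]

end LinearSubspace

/-! ### The arrangement, T-flats and closure -/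

section Arrangement

variable {T : Type*} [Tract T] {E : Type*} {r : ℕ} {φ : (Fin r → E) → T}

lemma exists_append_range_eq {k : ℕ} {i : Fin k → E} {b : Fin r → E} (hi : Injective i)
    (h : Set.range i ⊆ Set.range b) :
    ∃ (s : ℕ) (hs : r = k + s) (w : Fin s → E),
      Set.range (Fin.append i w ∘ Fin.cast hs) = Set.range b := by
  choose g hg using fun l => h ⟨l, rfl⟩
  have hginj : Injective g := Injective.of_comp (f := b) (by
    rwa [show b ∘ g = i from funext hg])
  have hk : k ≤ r := by simpa using Fintype.card_le_of_injective _ hginj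
  obtain ⟨e, he⟩ := exists_bijective_append (q := r - k) hginj (by simp; omega)
  refine ⟨r - k, by omega, b ∘ e, ?_⟩
  have : Fin.append i (b ∘ e) = b ∘ Fin.append g e := by
    funext z
    refine Fin.addCases (fun j => ?_) (fun j => ?_) z <;> simp [hg]
  have hs : r = k + (r - k) := by omega
  rw [this, Surjective.range_comp (f := Fin.cast hs) (finCongr hs).surjective, he.2.range_comp]

lemma IsCovector.quotientBy {X : E → T} (hX : IsCovector φ X) {k s : ℕ} (h : r = k + s)
    {i : Fin k → E} (hi : ∀ l, X (i l) = 0) : IsCovector (quotientBy h φ i) X := by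
  subst h
  intro b e
  have := hX (Fin.append i b) e
  simp only [Cramer, Fin.sum_univ_add, Fin.append_left, Fin.append_right, hi, zero_mul, neg_zero',
    ambient_zero, Finset.sum_const_zero, zero_add, ← append_update] at this
  simpa [Cramer, Tract.quotientBy] using this

variable [Fintype E]

/-- The circuit in `b ∪ {e}`. -/
noncomputable def circuit (φ : (Fin r → E) → T) (b : Fin r → E) (e : E) : E → T :=
  extend (Fin.cons e b : Fin (r + 1) → E) (Fin.cons (φ b) fun l => neg (φ (update b l e))) 0

lemma orth_circuit_iff {b : Fin r → E} {e : E} (hb : Injective b) (he : e ∉ Set.range b)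
    (X : E → T) : Orth (circuit φ b e) X ↔ Cramer φ X b e := by
  have hinj : Injective (Fin.cons e b : Fin (r + 1) → E) := Fin.cons_injective_iff.2 ⟨he, hb⟩
  rw [cramer_iff_sumNull, Orth, SumNull, sum_extend hinj]
  · simp only [circuit, hinj.extend_apply, SumNull]
  · intro z hz
    rw [circuit, extend_apply' _ _ _ hz]
    simp

variable [LinearOrder E]

lemma mem_arrangementInter_iff (hφ : IsGrassmannPlucker φ) {F : Set E} {X : E → T} :
    X ∈ arrangementInter φ F ↔ IsCovector φ X ∧ ∀ i ∈ F, X i = 0 := by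
  simp only [arrangementInter, arrangement, Set.mem_inter_iff, Set.mem_iInter, Set.mem_ofPred_eq,
    mem_covectors_iff hφ]
  exact ⟨fun h => ⟨h.1, fun i hi => (h.2 i hi).2⟩, fun h => ⟨h.1, fun i hi => ⟨h.1, h.2 i hi⟩⟩⟩

omit [LinearOrder E] in
-- The equations of the quotient are among those of φ, and circuits satisfy the latter by the
-- Plücker relations.
lemma circuit_mem_tFlat (hT : IsPerfect T) (hφ : IsGrassmannPlucker φ) (F : Set E) {b : Fin r → E}
    {e : E} (hb : Injective b) (he : e ∉ Set.range b) : circuit φ b e ∈ tFlat φ hφ F := by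
  intro k s h i _ _ m hm w
  subst hm
  subst h
  have key := isCovector_cocircuit hT φ hφ (Fin.snoc (Fin.append i w) e : Fin (k + m + 1) → E)
    (Fin.last _) b e
  simp only [Fin.update_snoc_last] at key
  refine (orth_circuit_iff hb he _).2 ?_
  simpa [quotientBy, Fin.append_snoc] using key

omit [LinearOrder E] in
-- The element f is a loop of the quotient: a base containing f besides the entries of i would make
-- the basis i of F extendable within F.
lemma single_mem_tFlat [DecidableEq E] (hφ : IsGrassmannPlucker φ) {F : Set E} {f : E}
    (hf : f ∈ F) : (Pi.single f 1 : E → T) ∈ tFlat φ hφ F := by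
  intro k s h i _ hbasis m hm w
  subst hm
  subst h
  unfold SumNull
  rw [Finset.sum_eq_zero]
  · exact Ideal.zero_mem _
  intro z _
  by_cases hz : z = f
  swap
  · simp [hz]
  subst hz
  by_cases h0 : φ (Fin.append i (Fin.snoc w z)) = 0
  · simp [quotientBy, h0]
  have hi : insert z (Set.range i) ⊆ Set.range (Fin.append i (Fin.snoc w z : Fin (m + 1) → E)) := by
    rintro y (rfl | ⟨l, rfl⟩)
    · exact ⟨Fin.natAdd k (Fin.last m), by rw [Fin.append_right, Fin.snoc_last]⟩
    · exact ⟨Fin.castAdd (m + 1) l, by simp⟩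
  obtain ⟨l, hl⟩ := hbasis.mem_of_insert_indep hf (hφ.indep_iff.2 ⟨_, h0, hi⟩)
  refine absurd hl ((Fin.append_injective_iff.1 (hφ.isAlternating.injective h0)).2.2 l
    (Fin.last m) ∘ fun h => ?_)
  rw [h, Fin.snoc_last]

lemma perp_tFlat_subset (hT : IsPerfect T) (hφ : IsGrassmannPlucker φ) (F : Set E) :
    perp (tFlat φ hφ F) ⊆ arrangementInter φ F := by
  intro X hX
  refine (mem_arrangementInter_iff hφ).2 ⟨?_, fun f hf => ?_⟩
  · refine isCovector_of_ne_zero hφ.isAlternating fun b e hb => ?_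
    have hinj := hφ.isAlternating.injective hb
    by_cases he : e ∈ Set.range b
    · obtain ⟨s, rfl⟩ := he
      exact cramer_mem hφ.isAlternating X b s
    exact (orth_circuit_iff hinj he X).1 (orth_comm.1 (hX _ (circuit_mem_tFlat hT hφ F hinj he)))
  · have := hX _ (single_mem_tFlat hφ hf)
    rw [Orth, SumNull, Finset.sum_eq_single f (by intro z _ hz; simp [hz]) (by simp)] at this
    exact eq_zero_of_ambient_mem (by simpa using this)

omit [LinearOrder E] in
lemma exists_basis_quotientBy (hφ : IsGrassmannPlucker φ) (F : Set E) :
    ∃ (k s : ℕ) (h : r = k + s) (i : Fin k → E) (w : Fin s → E), Injective i ∧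
      (underlyingMatroid φ hφ).IsBasis (Set.range i) F ∧ quotientBy h φ i w ≠ 0 := by
  obtain ⟨I, hI⟩ := (underlyingMatroid φ hφ).exists_isBasis F (Set.subset_univ F)
  obtain ⟨k, i, hi, rfl⟩ := I.toFinite.fin_param
  obtain ⟨b, hb, hib⟩ := hφ.indep_iff.1 hI.indep
  obtain ⟨s, h, w, hw⟩ := exists_append_range_eq hi hib
  exact ⟨k, s, h, i, w, hi, hI, hφ.isAlternating.ne_zero_of_range_eq hb hw.symm⟩

lemma arrangementInter_eq {k s : ℕ} {h : r = k + s} {i : Fin k → E} {w : Fin s → E}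
    (hT : IsPerfect T) (hφ : IsGrassmannPlucker φ) {F : Set E} (hi : Injective i)
    (hI : (underlyingMatroid φ hφ).IsBasis (Set.range i) F) (hw : quotientBy h φ i w ≠ 0) :
    arrangementInter φ F = perp (tFlat φ hφ F) ∧
      arrangementInter φ F = covectorSet (quotientBy h φ i) := by
  have h1 : arrangementInter φ F ⊆ covectorSet (quotientBy h φ i) := by
    intro X hX
    obtain ⟨hX, h0⟩ := (mem_arrangementInter_iff hφ).1 hX
    exact hX.quotientBy h fun l => h0 _ (hI.subset ⟨l, rfl⟩)
  -- Perfection is applied to the quotient, whose vector set contains the T-flat.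
  have h2 : covectorSet (quotientBy h φ i) ⊆ perp (tFlat φ hφ F) := fun X hX Y hY =>
    orth_comm.1 (orth_of_isPerfect hT (hφ.quotientBy h i hw) (hY k s h i hi hI) hX)
  have h3 := perp_tFlat_subset hT hφ F
  exact ⟨(h1.trans h2).antisymm h3, h1.antisymm (h2.trans h3)⟩

/-- For e in the closure, Cramer's rule on a base extending I has only zero terms: a covector in H_F
vanishes on I, and replacing an element outside I by e gives no base. For e outside, complete I ∪
{e} to a base; its cocircuit at e lies in H_F but not in H_e. -/
lemma closure_eq_setOf_arrangementInter_subset (hT : IsPerfect T) (hφ : IsGrassmannPlucker φ)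
    (F : Set E) :
    (underlyingMatroid φ hφ).closure F = {e | arrangementInter φ F ⊆ arrangement φ e} := by
  obtain ⟨I, hI⟩ := (underlyingMatroid φ hφ).exists_isBasis F (Set.subset_univ F)
  have halt := hφ.isAlternating
  rw [← hI.closure_eq_closure]
  ext e
  constructor
  · intro he X hX
    obtain ⟨hX, h0⟩ := (mem_arrangementInter_iff hφ).1 hX
    refine ⟨(mem_covectors_iff hφ).2 hX, ?_⟩
    by_cases heI : e ∈ I
    · exact h0 e (hI.subset heI)
    have hdep := (hI.indep.mem_closure_iff.1 he).resolve_right heI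
    obtain ⟨b, hb, hIb⟩ := hφ.indep_iff.1 hI.indep
    refine (mul_eq_zero.1 ((hX b e).apply_mul_eq_zero fun l => ?_)).resolve_right hb
    by_cases hl : b l ∈ I
    · rw [h0 _ (hI.subset hl), zero_mul]
    · refine mul_eq_zero_of_right _ (by_contra fun hne => hdep.not_indep ?_)
      refine hφ.indep_iff.2 ⟨_, hne, ?_⟩
      rw [range_update (halt.injective hb)]
      exact Set.insert_subset_insert fun z hz => ⟨hIb hz, fun h => hl (h ▸ hz)⟩
  · intro he
    by_contra hcl
    obtain ⟨hind, heI⟩ := (hI.indep.notMem_closure_iff (Set.mem_univ e)).1 hcl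
    obtain ⟨c, hc, hsub⟩ := hφ.indep_iff.1 hind
    obtain ⟨l, rfl⟩ := hsub (Set.mem_insert e I)
    have hmem : cocircuit φ c l ∈ arrangementInter φ F := by
      refine (mem_arrangementInter_iff hφ).2 ⟨cocircuit_mem hT hφ c l, fun f hf => ?_⟩
      refine mul_eq_zero_of_right _ (by_contra fun hne => ?_)
      -- If the cocircuit were nonzero at f, then I ∪ {f} would be independent and f would lie in I
      -- by maximality; but then replacing e by f repeats an entry.
      have hfI : f ∈ I := by
        refine hI.mem_of_insert_indep hf (hφ.indep_iff.2 ⟨_, hne, ?_⟩)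
        rw [range_update (halt.injective hc)]
        exact Set.insert_subset_insert fun z hz =>
          ⟨hsub (Set.mem_insert_of_mem _ hz), fun h => heI (h ▸ hz)⟩
      obtain ⟨t, rfl⟩ := hsub (Set.mem_insert_of_mem _ hfI)
      have htl : t ≠ l := fun h => heI (h ▸ hfI)
      exact hne (halt.eq_zero htl (by simp [htl]))
    have := (he hmem).2
    rw [cocircuit_self hc] at this
    exact one_ne_zero this

omit [LinearOrder E] in
lemma corank_eq {k s : ℕ} (h : r = k + s) {i : Fin k → E} (hφ : IsGrassmannPlucker φ) {F : Set E}
    (hi : Injective i) (hI : (underlyingMatroid φ hφ).IsBasis (Set.range i) F) :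
    (underlyingMatroid φ hφ).corank F = s := by
  have hrange : ∀ {n : ℕ} {x : Fin n → E}, Injective x → (Set.range x).encard = n := by
    intro n x hx
    rw [← Set.image_univ, hx.encard_image, Set.encard_univ, ENat.card_eq_coe_fintype_card,
      Fintype.card_fin]
  obtain ⟨_, b, rfl, hb⟩ := hφ.exists_base
  have h1 := ((underlyingMatroid_isBase hφ).2 ⟨b, rfl, hb⟩).encard_eq_eRank
  rw [Matroid.corank, ← h1, ← hI.encard_eq_eRk, hrange (hφ.isAlternating.injective hb), hrange hi,
    ← ENat.natCast_sub, ENat.toNat_natCast, h, Nat.add_sub_cancel_left]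

end Arrangement

end Tract

theorem propositionE {T : Type*} [Tract T] (hT : Tract.IsPerfect T)
    {E : Type*} [Fintype E] [LinearOrder E] {r : ℕ}
    (φ : (Fin r → E) → T) (hφ : Tract.IsGrassmannPlucker φ)
    (hsimple : (Tract.underlyingMatroid φ hφ).IsSimple) (F : Set E) :
    ((Tract.underlyingMatroid φ hφ).IsFlat F ↔
      F = {i | Tract.arrangementInter φ F ⊆ Tract.arrangement φ i}) ∧
    ((Tract.underlyingMatroid φ hφ).IsFlat F →
      Tract.arrangementInter φ F = Tract.perp (Tract.tFlat φ hφ F) ∧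
      Tract.IsLinearSubspace (Tract.arrangementInter φ F) ∧
      Tract.HasDimension (Tract.arrangementInter φ F)
        ((Tract.underlyingMatroid φ hφ).corank F)) := by
  refine ⟨?_, fun _ => ?_⟩
  · rw [Matroid.isFlat_iff_closure_eq,
      ← Tract.closure_eq_setOf_arrangementInter_subset hT hφ F, eq_comm]
  · obtain ⟨k, s, h, i, w, hi, hI, hw⟩ := Tract.exists_basis_quotientBy hφ F
    obtain ⟨h1, h2⟩ := Tract.arrangementInter_eq hT hφ hi hI hw
    have hq := hφ.quotientBy h i hw
    refine ⟨h1, ?_, ?_⟩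
    · rw [h2]
      exact Tract.isLinearSubspace_covectorSet hT hq
    · rw [h2, Tract.corank_eq h hφ hi hI]
      exact Tract.hasDimension_covectorSet hT hq
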